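/- For a finite simple graph $G$, let $Q(G)=D(G)+A(G)$ be its signless Laplacian matrix, where $D(G)$ is the diagonal matrix of the vertex degrees and $A(G)$ is the adjacency matrix, and let $q(G)$ be the largest eigenvalue of $Q(G)$. Let $K_{k+1}[t]$ be the complete $(k+1)$-partite graph in which every part has exactly $t$ vertices. **Theorem.** Let $k\ge 2$ be an integer and let $\varepsilon>0$ be a real number. Then there exist a constant $c>0$ and an integer $n_0$, both depending only on $k$ and $\varepsilon$, such that every graph $G$ on $n\ge n_0$ vertices with $$q(G)\ \ge\ \Bigl(1-\frac1k+\varepsilon\Bigr)2n$$ contains a (not necessarily induced) subgraph isomorphic to $K_{k+1}[t]$ for some integer $t\ge c\log n$. -/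

import Mathlib

namespace SimpleGraph

/-- The signless Laplacian matrix `Q(G) = D(G) + A(G)` of a finite graph, with real entries. -/
def signlessLapMatrix {V : Type*} [Fintype V] [DecidableEq V] (G : SimpleGraph V)
    [DecidableRel G.Adj] : Matrix V V ℝ :=
  G.degMatrix ℝ + G.adjMatrix ℝ

/-- The signless Laplacian spectral radius `q(G)`: the largest eigenvalue of `Q(G)`.
By `isGreatest_signlessSpectralRadius` below, the supremum is a maximum
as soon as `G` has a vertex. -/
noncomputable def signlessSpectralRadius {V : Type*} [Fintype V] [DecidableEq V]
    (G : SimpleGraph V) [DecidableRel G.Adj] : ℝ :=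
  sSup {μ : ℝ | Module.End.HasEigenvalue (Matrix.toLin' G.signlessLapMatrix) μ}

theorem isHermitian_signlessLapMatrix {V : Type*} [Fintype V] [DecidableEq V]
    (G : SimpleGraph V) [DecidableRel G.Adj] : G.signlessLapMatrix.IsHermitian :=
  (G.isHermitian_degMatrix ℝ).add (G.isHermitian_adjMatrix ℝ)

theorem isGreatest_signlessSpectralRadius {V : Type*} [Fintype V] [DecidableEq V] [Nonempty V]
    (G : SimpleGraph V) [DecidableRel G.Adj] :
    IsGreatest {μ : ℝ | Module.End.HasEigenvalue (Matrix.toLin' G.signlessLapMatrix) μ}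
      G.signlessSpectralRadius := by
  have hspec : {μ : ℝ | Module.End.HasEigenvalue (Matrix.toLin' G.signlessLapMatrix) μ} =
      Set.range G.isHermitian_signlessLapMatrix.eigenvalues := by
    rw [← Matrix.IsHermitian.spectrum_real_eq_range_eigenvalues]
    ext μ
    rw [Set.mem_ofPred_eq, Module.End.hasEigenvalue_iff_mem_spectrum, Matrix.spectrum_toLin']
  have hne : {μ : ℝ | Module.End.HasEigenvalue
      (Matrix.toLin' G.signlessLapMatrix) μ}.Nonempty := by
    rw [hspec]; exact Set.range_nonempty _
  have hfin : {μ : ℝ | Module.End.HasEigenvalue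
      (Matrix.toLin' G.signlessLapMatrix) μ}.Finite := by
    rw [hspec]; exact Set.finite_range _
  exact ⟨hne.csSup_mem hfin, fun _ hμ => le_csSup hfin.bddAbove hμ⟩

end SimpleGraph

/-! The spectral hypothesis reduces to a minimum degree condition on a large vertex set. Among
nonempty `S`, with `m = |S|` and `q(S)` the top eigenvalue of the induced subgraph, maximise the
potential `q(S)/m + η log m`. Since `q(S) ≤ 2m`, the maximiser loses only a constant in `log n`. If
its unit Perron vector had a squared entry of at most `(1 - γ)/m`, deleting the smallest entry would
raise the potential (`erase_bound`, `add_log_lt_of_le_mul`). So the vector is nearly constant, and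
the eigenvalue equation with Cauchy–Schwarz forces every degree to be at least about `q(S)/2`
(`sq_sub_degree_mul_le`).

These degrees exceed `(1 - 1/k)m` by a fixed proportion, so `exists_hasBlowup_of_le_card_neighbors`,
an Erdős–Stone induction on the number of parts, gives parts of order `log m`. -/

namespace SimpleGraph

/-! ### Erdős–Stone for minimum degree, with logarithmic parts -/

/-- `G` has pairwise completely joined vertex sets `A i ⊆ S`, `i < r`, each of size `t`. -/
def HasBlowup {V : Type*} (G : SimpleGraph V) (S : Finset V) (r t : ℕ) : Prop :=
  ∃ A : Fin r → Finset V, (∀ i, A i ⊆ S) ∧ (∀ i, (A i).card = t) ∧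
    ∀ i j, i ≠ j → ∀ a ∈ A i, ∀ b ∈ A j, G.Adj a b

theorem HasBlowup.isContained {V : Type*} {G : SimpleGraph V} {S : Finset V} {r t : ℕ}
    (h : G.HasBlowup S r t) : (completeEquipartiteGraph r t).IsContained G := by
  obtain ⟨A, -, hcard, hadj⟩ := h
  let e (i : Fin r) : Fin t ≃ A i := ((A i).equivFinOfCardEq (hcard i)).symm
  have hmap : ∀ {p q : Fin r × Fin t}, p.1 ≠ q.1 → G.Adj (e p.1 p.2) (e q.1 q.2) :=
    fun h => hadj _ _ h _ (e _ _).2 _ (e _ _).2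
  refine ⟨⟨⟨fun p => e p.1 p.2, fun {p q} h => hmap (by simpa using h)⟩, ?_⟩⟩
  rintro ⟨i, a⟩ ⟨j, b⟩ h
  by_cases hij : i = j
  · subst hij
    simpa using h
  · exact absurd h (hmap (p := (i, a)) (q := (j, b)) hij).ne

/-- If every vertex of `S` has more than `(r - 1 + ε) / r` of `S` as neighbours, then at least
`ε / 2` of the vertices of `S` have `t` neighbours in each of `r` given sets of size `T`. -/
theorem card_filter_many_neighbors {V : Type*} {G : SimpleGraph V}
    [DecidableRel G.Adj] {S : Finset V} {r T t : ℕ} {ε : ℝ} (hr : 0 < r) (hT : 0 < T)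
    (ht : (t : ℝ) ≤ ε / 2 * T)
    (hdeg : ∀ v ∈ S, ((r : ℝ) - 1 + ε) * S.card ≤ r * (S.filter (G.Adj v)).card)
    (A : Fin r → Finset V) (hAS : ∀ i, A i ⊆ S) (hA : ∀ i, (A i).card = T) :
    ε / 2 * S.card ≤ (S.filter fun v => ∀ i, t ≤ ((A i).filter (G.Adj v)).card).card := by
  classical
  set P : V → Prop := fun v => ∀ i, t ≤ ((A i).filter (G.Adj v)).card with hP
  have hcount : ∑ i, ∑ w ∈ A i, ((S.filter (G.Adj w)).card : ℝ) =
      ∑ v ∈ S, ∑ i, (((A i).filter (G.Adj v)).card : ℝ) := by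
    rw [Finset.sum_comm (s := S)]
    refine Finset.sum_congr rfl fun i _ => ?_
    simp only [Finset.card_filter, Nat.cast_sum]
    rw [Finset.sum_comm]
    simp only [G.adj_comm]
  have hlow : (T : ℝ) * (((r : ℝ) - 1 + ε) * S.card) ≤
      ∑ i, ∑ w ∈ A i, ((S.filter (G.Adj w)).card : ℝ) := by
    have hr' : (0 : ℝ) < r := by exact_mod_cast hr
    have h1 : ∀ i, (T : ℝ) * (((r : ℝ) - 1 + ε) * S.card / r) ≤
        ∑ w ∈ A i, ((S.filter (G.Adj w)).card : ℝ) := fun i => by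
      rw [← nsmul_eq_mul, ← hA i]
      refine Finset.card_nsmul_le_sum _ _ _ fun w hw => ?_
      rw [div_le_iff₀ hr', mul_comm _ (r : ℝ)]
      exact hdeg w (hAS i hw)
    calc (T : ℝ) * (((r : ℝ) - 1 + ε) * S.card)
        = ∑ _i : Fin r, (T : ℝ) * (((r : ℝ) - 1 + ε) * S.card / r) := by
          simp; field_simp
      _ ≤ _ := Finset.sum_le_sum fun i _ => h1 i
  -- A vertex failing `P` has fewer than `t` neighbours in some `A i`, hence at most `(r - 1)T + t`
  -- in all. The average is at least `(r - 1 + ε)T`, so `P` must hold often.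
  have hup : ∀ v ∈ S, ∑ i, (((A i).filter (G.Adj v)).card : ℝ) ≤
      ((r : ℝ) - 1) * T + t + if P v then (T : ℝ) else 0 := fun v _ => by
    have hle : ∀ i, (((A i).filter (G.Adj v)).card : ℝ) ≤ T := fun i => by
      rw [← hA i]; exact_mod_cast Finset.card_filter_le _ _
    split_ifs with h
    · calc ∑ i, (((A i).filter (G.Adj v)).card : ℝ) ≤ ∑ _i : Fin r, (T : ℝ) :=
            Finset.sum_le_sum fun i _ => hle i
        _ ≤ _ := by simp; nlinarith [(Nat.cast_nonneg t : (0 : ℝ) ≤ t)]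
    · simp only [hP, not_forall, not_le] at h
      obtain ⟨i, hi⟩ := h
      rw [← Finset.add_sum_erase _ _ (Finset.mem_univ i)]
      have h2 : ∑ j ∈ Finset.univ.erase i, (((A j).filter (G.Adj v)).card : ℝ) ≤
          ∑ _j ∈ Finset.univ.erase i, (T : ℝ) := Finset.sum_le_sum fun j _ => hle j
      have h3 : ∑ _j ∈ Finset.univ.erase i, (T : ℝ) = ((r : ℝ) - 1) * T := by
        rw [Finset.sum_const, nsmul_eq_mul, Finset.card_erase_of_mem (Finset.mem_univ i),
          Finset.card_univ, Fintype.card_fin, Nat.cast_pred hr]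
      have h4 : (((A i).filter (G.Adj v)).card : ℝ) ≤ t := by exact_mod_cast hi.le
      linarith
  have hsum := Finset.sum_le_sum hup
  rw [← hcount, Finset.sum_add_distrib, Finset.sum_const, nsmul_eq_mul, ← Finset.sum_filter,
    Finset.sum_const, nsmul_eq_mul] at hsum
  have hT' : (0 : ℝ) < T := by exact_mod_cast hT
  have h5 := mul_le_mul_of_nonneg_left ht (Nat.cast_nonneg (α := ℝ) S.card)
  refine le_of_mul_le_mul_right ?_ hT'
  nlinarith

/-- One step of the Erdős–Stone argument: `r` completely joined sets of size `T` give `r + 1`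
completely joined sets of size `t`. -/
theorem HasBlowup.succ {V : Type*} {G : SimpleGraph V} [DecidableRel G.Adj] {S : Finset V}
    {r T t : ℕ} {ε : ℝ} (hr : 0 < r) (hT : 0 < T) (ht : (t : ℝ) ≤ ε / 2 * T)
    (hdeg : ∀ v ∈ S, ((r : ℝ) - 1 + ε) * S.card ≤ r * (S.filter (G.Adj v)).card)
    (hcard : (2 : ℝ) ^ (r * T) * t ≤ ε / 2 * S.card) (h : G.HasBlowup S r T) :
    G.HasBlowup S (r + 1) t := by
  classical
  obtain ⟨A, hAS, hA, hadj⟩ := h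
  have hg := hcard.trans (card_filter_many_neighbors hr hT ht hdeg A hAS hA)
  set X := S.filter fun v => ∀ i, t ≤ ((A i).filter (G.Adj v)).card with hX
  have hmaps : ∀ v ∈ X, (fun i => (A i).filter (G.Adj v)) ∈
      Fintype.piFinset fun i => (A i).powerset := fun v _ => by
    simp [Fintype.mem_piFinset]
  -- Pigeonhole over the `2 ^ (r * T)` possible traces on the `A i`: some `t` vertices share one
  -- trace `B`.
  obtain ⟨B, -, hB⟩ := Finset.exists_le_card_fiber_of_mul_le_card_of_maps_to (n := t) hmaps
    ⟨fun _ => ∅, by simp [Fintype.mem_piFinset]⟩ (by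
      rw [Fintype.card_piFinset]
      simp only [Finset.card_powerset, hA, Finset.prod_const, Finset.card_univ, Fintype.card_fin]
      rw [← pow_mul, mul_comm T]
      exact_mod_cast hg)
  obtain ⟨Y, hY, hYt⟩ := Finset.exists_subset_card_eq hB
  have hYX : ∀ v ∈ Y, v ∈ X ∧ ∀ i, (A i).filter (G.Adj v) = B i := fun v hv => by
    have := Finset.mem_filter.1 (hY hv)
    exact ⟨this.1, fun i => congrFun this.2 i⟩
  have hC : ∀ i, ∃ C ⊆ A i, C.card = t ∧ ∀ v ∈ Y, ∀ a ∈ C, G.Adj v a := fun i => by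
    -- An empty `Y` means `t = 0`, where no vertex certifies the size of `B i`.
    rcases Y.eq_empty_or_nonempty with rfl | ⟨v, hv⟩
    · exact ⟨∅, by simp, by simpa using hYt, by simp⟩
    · have hcard := (Finset.mem_filter.1 (hYX v hv).1).2 i
      rw [(hYX v hv).2 i] at hcard
      obtain ⟨C, hC, hCt⟩ := Finset.exists_subset_card_eq hcard
      refine ⟨C, fun a ha => ?_, hCt, fun w hw a ha => ?_⟩
      · have := hC ha
        rw [← (hYX v hv).2 i] at this
        exact (Finset.mem_filter.1 this).1
      · have := hC ha
        rw [← (hYX w hw).2 i] at this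
        exact (Finset.mem_filter.1 this).2
  choose C hCA hCt hCY using hC
  refine ⟨Fin.cons Y C, fun i => ?_, fun i => ?_, fun i j => ?_⟩
  · refine Fin.cases ?_ (fun i => ?_) i
    · exact fun v hv => (Finset.mem_filter.1 (hYX v hv).1).1
    · exact (hCA i).trans (hAS i)
  · refine Fin.cases ?_ (fun i => ?_) i
    · exact hYt
    · exact hCt i
  · refine Fin.cases ?_ (fun i => ?_) i <;> refine Fin.cases ?_ (fun j => ?_) j
    · exact fun h => absurd rfl h
    · exact fun _ a ha b hb => hCY j a ha b hb
    · exact fun _ a ha b hb => (hCY i b hb a ha).symm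
    · exact fun h a ha b hb => hadj i j (fun h' => h (congrArg _ h')) a (hCA i ha) b (hCA j hb)

/-- The minimum degree version of the **Erdős–Stone theorem**, with parts of logarithmic size. -/
theorem exists_hasBlowup_of_le_card_neighbors (r : ℕ) (ε : ℝ) (hε : 0 < ε) :
    ∃ c : ℝ, 0 < c ∧ ∃ N : ℕ, ∀ (V : Type*) (G : SimpleGraph V) [DecidableRel G.Adj]
      (S : Finset V), N ≤ S.card →
      (∀ v ∈ S, ((r : ℝ) - 1 + ε) * S.card ≤ r * (S.filter (G.Adj v)).card) →
      ∀ t : ℕ, (t : ℝ) ≤ c * Real.log S.card → G.HasBlowup S (r + 1) t := by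
  induction r generalizing ε with
  | zero =>
    refine ⟨1, one_pos, 1, fun V G _ S _ _ t ht => ?_⟩
    have h1 : (t : ℝ) ≤ S.card := by
      rw [one_mul] at ht
      exact ht.trans (Real.log_le_self (Nat.cast_nonneg _))
    obtain ⟨Y, hY, hYt⟩ := Finset.exists_subset_card_eq (Nat.cast_le.1 h1)
    exact ⟨fun _ => Y, fun _ => hY, fun _ => hYt, fun i j h => absurd (Subsingleton.elim (α := Fin 1) i j) h⟩
  | succ r ih =>
    -- Since `r * r / (r + 1) = r - 1 + 1 / (r + 1)`, the degree condition for `r + 1` implies the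
    -- one for `r` with this slack, whatever `ε` is.
    obtain ⟨c', hc', N', h⟩ := ih (1 / (r + 1)) (by positivity)
    -- The second bound keeps `2 ^ ((r + 1) * T)` below `√|S|`.
    set c₁ : ℝ := min c' (1 / (2 * (r + 1))) with hc₁
    have hc₁pos : 0 < c₁ := lt_min hc' (by positivity)
    have hc₁r : (r + 1) * c₁ ≤ 1 / 2 := by
      have := mul_le_mul_of_nonneg_left (min_le_right c' (1 / (2 * ((r : ℝ) + 1))))
        (by positivity : (0 : ℝ) ≤ r + 1)
      refine this.trans (le_of_eq ?_)
      field_simp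
    have hc₁half : c₁ ≤ 1 / 2 := by nlinarith [(Nat.cast_nonneg r : (0 : ℝ) ≤ r)]
    obtain ⟨N₁, hN₁⟩ := Filter.eventually_atTop.1
      ((Real.tendsto_log_atTop.comp tendsto_natCast_atTop_atTop).eventually_ge_atTop (2 / c₁))
    -- As `c₁ log |S| ≥ 2`, the floor `T` is at least half of it, so `t ≤ ε / 2 * T`.
    refine ⟨ε * c₁ / 4, by positivity, max (max N' N₁) 1, fun V G _ S hS hdeg t ht => ?_⟩
    have hlog : 2 ≤ c₁ * Real.log S.card := by
      have := hN₁ S.card ((le_max_right _ _).trans ((le_max_left _ _).trans hS))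
      rw [Function.comp_apply, div_le_iff₀ hc₁pos] at this
      linarith
    have hSpos : (0 : ℝ) < S.card := by
      exact_mod_cast (le_max_right _ _).trans hS
    have hlogpos : 0 ≤ Real.log S.card := by
      by_contra hneg
      nlinarith
    set T := ⌊c₁ * Real.log S.card⌋₊ with hT
    have hTle : (T : ℝ) ≤ c₁ * Real.log S.card := Nat.floor_le (by positivity)
    have hTlt : c₁ * Real.log S.card < T + 1 := Nat.lt_floor_add_one _
    have hTpos : 0 < T := by
      have : (0 : ℝ) < T := by linarith
      exact_mod_cast this
    refine HasBlowup.succ (T := T) (ε := ε) r.succ_pos hTpos ?_ hdeg ?_ ?_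
    · nlinarith
    · have hsq : Real.sqrt S.card * Real.sqrt S.card = S.card := Real.mul_self_sqrt hSpos.le
      have hsqpos : 0 < Real.sqrt S.card := Real.sqrt_pos.2 hSpos
      have hpow : (2 : ℝ) ^ ((r + 1) * T) ≤ Real.sqrt S.card := by
        have h2 : (2 : ℝ) ≤ Real.exp 1 := by linarith [Real.add_one_le_exp (1 : ℝ)]
        calc (2 : ℝ) ^ ((r + 1) * T) ≤ Real.exp 1 ^ ((r + 1) * T) :=
              pow_le_pow_left₀ (by norm_num) h2 _
          _ = Real.exp (((r + 1) * T : ℕ) : ℝ) := by rw [← Real.exp_nat_mul, mul_one]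
          _ ≤ Real.exp (Real.log (Real.sqrt S.card)) := by
              rw [Real.exp_le_exp, Real.log_sqrt hSpos.le]
              push_cast
              nlinarith [mul_le_mul_of_nonneg_right hc₁r hlogpos,
                mul_le_mul_of_nonneg_left hTle (by positivity : (0 : ℝ) ≤ r + 1)]
          _ = Real.sqrt S.card := Real.exp_log hsqpos
      have hlogsq : Real.log S.card ≤ 2 * Real.sqrt S.card := by
        have := Real.log_le_self hsqpos.le
        rw [Real.log_sqrt hSpos.le] at this
        linarith
      have ht' : (t : ℝ) ≤ ε / 2 * Real.sqrt S.card := by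
        refine ht.trans ?_
        have h3 : c₁ * Real.log S.card ≤ 1 / 2 * (2 * Real.sqrt S.card) :=
          mul_le_mul hc₁half hlogsq hlogpos (by norm_num)
        nlinarith
      calc (2 : ℝ) ^ ((r + 1) * T) * t ≤ Real.sqrt S.card * (ε / 2 * Real.sqrt S.card) :=
            mul_le_mul hpow ht' (Nat.cast_nonneg _) hsqpos.le
        _ = ε / 2 * S.card := by rw [mul_left_comm, hsq]
    · refine h V G S ((le_max_left _ _).trans ((le_max_left _ _).trans hS)) (fun v hv => ?_) T
        (hTle.trans (mul_le_mul_of_nonneg_right (min_le_left _ _) hlogpos))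
      have hd := hdeg v hv
      have hr1 : (0 : ℝ) < r + 1 := by positivity
      have hr0 : (0 : ℝ) ≤ r := Nat.cast_nonneg r
      push_cast at hd
      refine le_of_mul_le_mul_left ?_ hr1
      have h6 : ((r : ℝ) + 1) * (((r : ℝ) - 1 + 1 / (r + 1)) * S.card) = r * (r * S.card) := by
        field_simp
        ring
      have h7 := mul_le_mul_of_nonneg_left hd hr0
      have h8 : 0 ≤ r * (ε * S.card) := by positivity
      rw [h6]
      nlinarith

end SimpleGraph

/-! ### Nonnegative maximal eigenvectors -/

/-- A real symmetric matrix with nonnegative entries has a nonnegative unit eigenvector whose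
eigenvalue bounds the quadratic form from above. -/
theorem Matrix.exists_nonneg_maximal_eigenvector {ι : Type*} [Fintype ι] [DecidableEq ι]
    [Nonempty ι] (M : Matrix ι ι ℝ) (hM : M.IsSymm) (hpos : ∀ i j, 0 ≤ M i j) :
    ∃ (q : ℝ) (x : ι → ℝ), (∀ i, 0 ≤ x i) ∧ ∑ i, x i ^ 2 = 1 ∧ M.mulVec x = q • x ∧
      ∀ y : ι → ℝ, y ⬝ᵥ M.mulVec y ≤ q * ∑ i, y i ^ 2 := by
  set K : Set (ι → ℝ) := {x | ∑ i, x i ^ 2 = 1} with hK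
  have hKc : IsCompact K := by
    refine (isCompact_univ_pi fun _ : ι => isCompact_Icc (a := (-1 : ℝ)) (b := 1)).of_isClosed_subset
      (isClosed_eq (by fun_prop) continuous_const) fun x hx i _ => ?_
    have : x i ^ 2 ≤ 1 := (Finset.single_le_sum (f := fun i => x i ^ 2)
      (fun j _ => sq_nonneg (x j)) (Finset.mem_univ i)).trans_eq hx
    exact abs_le.1 ((sq_le_one_iff_abs_le_one _).1 this)
  have hKne : K.Nonempty := by
    obtain ⟨i₀⟩ := ‹Nonempty ι›
    refine ⟨Pi.single i₀ 1, ?_⟩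
    simp [hK, Pi.single_apply]
  have hcont : Continuous fun x : ι → ℝ => x ⬝ᵥ M.mulVec x := by
    unfold dotProduct Matrix.mulVec dotProduct
    fun_prop
  obtain ⟨z, hz, hmax⟩ := hKc.exists_isMaxOn hKne hcont.continuousOn
  set q := z ⬝ᵥ M.mulVec z with hq
  have hbound : ∀ y : ι → ℝ, y ⬝ᵥ M.mulVec y ≤ q * ∑ i, y i ^ 2 := fun y => by
    have hs0 : 0 ≤ ∑ i, y i ^ 2 := Finset.sum_nonneg fun i _ => sq_nonneg _
    rcases hs0.eq_or_lt with hs | hs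
    · have hy : y = 0 := by
        funext i
        have := (Finset.sum_eq_zero_iff_of_nonneg fun i _ => sq_nonneg (y i)).1 hs.symm i
          (Finset.mem_univ i)
        simpa using this
      simp [hy]
    · set s := Real.sqrt (∑ i, y i ^ 2) with hsdef
      have hss : s ^ 2 = ∑ i, y i ^ 2 := Real.sq_sqrt hs0
      have hsp : 0 < s := Real.sqrt_pos.2 hs
      have hmem : s⁻¹ • y ∈ K := by
        simp only [hK, Set.mem_ofPred_eq, Pi.smul_apply, smul_eq_mul, mul_pow, ← Finset.mul_sum,
          ← hss]
        field_simp
      have := hmax hmem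
      simp only [Set.mem_ofPred_eq, Matrix.mulVec_smul, dotProduct_smul, smul_dotProduct,
        smul_eq_mul, ← hq] at this
      rw [← hss]
      calc y ⬝ᵥ M.mulVec y = (s⁻¹ * (s⁻¹ * (y ⬝ᵥ M.mulVec y))) * s ^ 2 := by field_simp
        _ ≤ q * s ^ 2 := mul_le_mul_of_nonneg_right this (sq_nonneg s)
  -- With nonnegative entries, passing to absolute values cannot decrease the form, so `|z|` is
  -- again a maximiser.
  have hxK : ∑ i, |z i| ^ 2 = 1 := by
    simp only [sq_abs]
    exact hz
  have hxq : (fun i => |z i|) ⬝ᵥ M.mulVec (fun i => |z i|) = q := by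
    refine le_antisymm ((hbound _).trans_eq (by rw [hxK, mul_one])) ?_
    rw [hq]
    simp only [dotProduct, Matrix.mulVec, Finset.mul_sum]
    refine Finset.sum_le_sum fun i _ => Finset.sum_le_sum fun j _ => ?_
    calc z i * (M i j * z j) ≤ |z i * (M i j * z j)| := le_abs_self _
      _ = |z i| * (M i j * |z j|) := by rw [abs_mul, abs_mul, abs_of_nonneg (hpos i j)]
  have hform : ∀ y : ι → ℝ, y ⬝ᵥ (q • (1 : Matrix ι ι ℝ) - M).mulVec y =
      q * ∑ i, y i ^ 2 - y ⬝ᵥ M.mulVec y := fun y => by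
    rw [Matrix.sub_mulVec, dotProduct_sub, Matrix.smul_mulVec, Matrix.one_mulVec, dotProduct_smul,
      smul_eq_mul]
    simp [dotProduct, sq]
  -- The form of `qI - M` is nonnegative and vanishes at `|z|`, so `|z|` lies in the kernel.
  have hpsd : (q • (1 : Matrix ι ι ℝ) - M).PosSemidef := by
    rw [Matrix.posSemidef_iff_dotProduct_mulVec]
    refine ⟨?_, fun y => ?_⟩
    · rw [Matrix.IsHermitian, Matrix.conjTranspose_eq_transpose_of_trivial]
      simp [hM.eq]
    · rw [star_trivial, hform]
      linarith [hbound y]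
  refine ⟨q, fun i => |z i|, fun i => abs_nonneg _, hxK, ?_, hbound⟩
  have h0 := (hpsd.dotProduct_mulVec_zero_iff fun i => |z i|).1 (by
    rw [star_trivial, hform, hxK, hxq, mul_one, sub_self])
  rw [Matrix.sub_mulVec, Matrix.smul_mulVec, Matrix.one_mulVec, sub_eq_zero] at h0
  exact h0.symm

/-- The nonnegative eigenvector for the largest eigenvalue of the signless Laplacian of the weighted
graph induced on `S`. -/
theorem exists_signless_eigenvector {V : Type*} (a : V → V → ℝ) (hsymm : ∀ i j, a i j = a j i)
    (hpos : ∀ i j, 0 ≤ a i j) (S : Finset V) (hS : S.Nonempty) :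
    ∃ (q : ℝ) (x : V → ℝ), (∀ i ∈ S, 0 ≤ x i) ∧ ∑ i ∈ S, x i ^ 2 = 1 ∧
      (∀ i ∈ S, ∑ j ∈ S, a i j * (x i + x j) = q * x i) ∧
      ∀ y : V → ℝ, ∑ i ∈ S, y i * ∑ j ∈ S, a i j * (y i + y j) ≤ q * ∑ i ∈ S, y i ^ 2 := by
  classical
  have : Nonempty S := hS.to_subtype
  let M : Matrix S S ℝ := Matrix.diagonal (fun i : S => ∑ j : S, a i j) +
    Matrix.of fun i j : S => a i j
  have hmul : ∀ (z : S → ℝ) (i : S), M.mulVec z i = ∑ j : S, a i j * (z i + z j) := fun z i => by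
    rw [Matrix.add_mulVec, Pi.add_apply, Matrix.mulVec_diagonal, Finset.sum_mul]
    simp only [Matrix.mulVec, dotProduct, Matrix.of_apply, mul_add, Finset.sum_add_distrib]
  obtain ⟨q, z, hz0, hz1, hzq, hbound⟩ := M.exists_nonneg_maximal_eigenvector
    (by
      ext i j
      by_cases h : i = j
      · subst h; simp
      · simp [M, Matrix.diagonal_apply_ne _ h, Matrix.diagonal_apply_ne _ (Ne.symm h), hsymm])
    (fun i j => by
      have : 0 ≤ Matrix.diagonal (fun i : S => ∑ j : S, a i j) i j := by
        rw [Matrix.diagonal_apply]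
        split_ifs
        · exact Finset.sum_nonneg fun _ _ => hpos _ _
        · exact le_rfl
      exact add_nonneg this (hpos _ _))
  refine ⟨q, fun v => if h : v ∈ S then z ⟨v, h⟩ else 0, fun i hi => ?_, ?_, fun i hi => ?_,
    fun y => ?_⟩
  · simp [hi, hz0]
  · rw [← Finset.sum_coe_sort]
    simpa using hz1
  · rw [← Finset.sum_coe_sort]
    have := congrFun hzq ⟨i, hi⟩
    rw [hmul] at this
    simpa [hi] using this
  · have := hbound fun i => y i
    simp only [dotProduct, hmul] at this
    rw [← Finset.sum_coe_sort S fun i => y i ^ 2, ← Finset.sum_coe_sort]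
    simp only [← Finset.sum_coe_sort S]
    exact this

/-- `x` is a nonnegative unit eigenvector for the largest eigenvalue `q` of the signless Laplacian
of the graph with edge weights `a` induced on `S`. -/
structure IsSignlessPerron {V : Type*} (a : V → V → ℝ) (S : Finset V) (q : ℝ) (x : V → ℝ) :
    Prop where
  nonneg : ∀ i ∈ S, 0 ≤ x i
  norm : ∑ i ∈ S, x i ^ 2 = 1
  eig : ∀ i ∈ S, ∑ j ∈ S, a i j * (x i + x j) = q * x i
  bound : ∀ y : V → ℝ, ∑ i ∈ S, y i * ∑ j ∈ S, a i j * (y i + y j) ≤ q * ∑ i ∈ S, y i ^ 2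

/-! ### Vertex deletion and degrees -/

namespace IsSignlessPerron

variable {V : Type*} {a : V → V → ℝ} {S : Finset V} {q : ℝ} {x : V → ℝ}

theorem form_eq (h : IsSignlessPerron a S q x) :
    ∑ i ∈ S, x i * ∑ j ∈ S, a i j * (x i + x j) = q := by
  calc ∑ i ∈ S, x i * ∑ j ∈ S, a i j * (x i + x j) = ∑ i ∈ S, q * x i ^ 2 :=
        Finset.sum_congr rfl fun i hi => by rw [h.eig i hi]; ring
    _ = q := by rw [← Finset.mul_sum, h.norm, mul_one]

theorem le_two_mul_card (h : IsSignlessPerron a S q x) (ha : ∀ i j, a i j ≤ 1) :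
    q ≤ 2 * S.card := by
  rw [← h.form_eq]
  calc ∑ i ∈ S, x i * ∑ j ∈ S, a i j * (x i + x j)
      ≤ ∑ i ∈ S, ∑ j ∈ S, (3 / 2 * x i ^ 2 + 1 / 2 * x j ^ 2) := by
        refine Finset.sum_le_sum fun i hi => ?_
        rw [Finset.mul_sum]
        refine Finset.sum_le_sum fun j hj => ?_
        have hi0 := h.nonneg i hi
        have hj0 := h.nonneg j hj
        have := mul_le_mul_of_nonneg_right (ha i j) (mul_nonneg hi0 (add_nonneg hi0 hj0))
        nlinarith [sq_nonneg (x i - x j)]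
    _ = 2 * S.card := by
        simp only [Finset.sum_add_distrib, ← Finset.mul_sum, Finset.sum_const, nsmul_eq_mul, h.norm]
        ring

/-- Deleting a vertex `u` where the eigenvector is smallest. -/
theorem erase_bound [DecidableEq V] (h : IsSignlessPerron a S q x) (ha : ∀ i j, a i j ≤ 1)
    (hsymm : ∀ i j, a i j = a j i) (hirr : ∀ i, a i i = 0) {u : V} (hu : u ∈ S)
    (hmin : ∀ i ∈ S, x u ≤ x i) {q' : ℝ} {x' : V → ℝ}
    (h' : IsSignlessPerron a (S.erase u) q' x') :
    q - 1 - (2 * q - S.card) * x u ^ 2 ≤ q' * (1 - x u ^ 2) := by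
  have hnorm : ∑ i ∈ S.erase u, x i ^ 2 = 1 - x u ^ 2 := by
    have := Finset.add_sum_erase S (fun i => x i ^ 2) hu
    rw [h.norm] at this
    linarith
  have hb := h'.bound x
  rw [hnorm] at hb
  refine le_trans ?_ hb
  -- The form is a sum of `a i j * (x i + x j) ^ 2` over edges; this separates the edges at `u`.
  have hsplit : q = ∑ i ∈ S.erase u, x i * ∑ j ∈ S.erase u, a i j * (x i + x j) +
      ∑ j ∈ S, a u j * (x u + x j) ^ 2 := by
    have h1 : ∀ i, ∑ j ∈ S, a i j * (x i + x j) =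
        a i u * (x i + x u) + ∑ j ∈ S.erase u, a i j * (x i + x j) := fun i =>
      (Finset.add_sum_erase S (fun j => a i j * (x i + x j)) hu).symm
    have h2 : ∑ j ∈ S, a u j * (x u + x j) ^ 2 =
        ∑ j ∈ S.erase u, a u j * (x u + x j) ^ 2 := by
      rw [← Finset.add_sum_erase S (fun j => a u j * (x u + x j) ^ 2) hu, hirr, zero_mul, zero_add]
    rw [h2, ← h.form_eq, ← Finset.add_sum_erase S _ hu, h1 u, hirr, zero_mul, zero_add,
      Finset.mul_sum, ← Finset.sum_add_distrib, ← Finset.sum_add_distrib]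
    refine Finset.sum_congr rfl fun i _ => ?_
    rw [h1 i, hsymm i u]
    ring
  -- Write `(x u + x j) ^ 2 = 2 * x u * (x u + x j) + (x j ^ 2 - x u ^ 2)`. The eigenvalue equation
  -- sums the first term; minimality of `x u` allows weight `1` in the second.
  have hdel : ∑ j ∈ S, a u j * (x u + x j) ^ 2 ≤ 1 + (2 * q - S.card) * x u ^ 2 := by
    calc ∑ j ∈ S, a u j * (x u + x j) ^ 2
        ≤ ∑ j ∈ S, (2 * x u * (a u j * (x u + x j)) + (x j ^ 2 - x u ^ 2)) := by
          refine Finset.sum_le_sum fun j hj => ?_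
          have h2 : 0 ≤ x j ^ 2 - x u ^ 2 :=
            sub_nonneg.2 (pow_le_pow_left₀ (h.nonneg u hu) (hmin j hj) 2)
          nlinarith [mul_le_mul_of_nonneg_right (ha u j) h2]
      _ = 1 + (2 * q - S.card) * x u ^ 2 := by
          rw [Finset.sum_add_distrib, ← Finset.mul_sum, h.eig u hu, Finset.sum_sub_distrib, h.norm,
            Finset.sum_const, nsmul_eq_mul]
          ring
  linarith

/-- When all squared entries of the eigenvector are at least `s`, all degrees are large. -/
theorem sq_sub_degree_mul_le (h : IsSignlessPerron a S q x) (ha0 : ∀ i j, 0 ≤ a i j)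
    (ha : ∀ i j, a i j ≤ 1) {s : ℝ} (hs : ∀ i ∈ S, s ≤ x i ^ 2) {v : V} (hv : v ∈ S) :
    (q - ∑ j ∈ S, a v j) ^ 2 * s ≤
      (∑ j ∈ S, a v j) * (1 - (S.card - ∑ j ∈ S, a v j) * s) := by
  set d := ∑ j ∈ S, a v j with hd
  have hd0 : 0 ≤ d := Finset.sum_nonneg fun j _ => ha0 v j
  have heig : (q - d) * x v = ∑ j ∈ S, a v j * x j := by
    have := h.eig v hv
    simp only [mul_add, Finset.sum_add_distrib, ← Finset.sum_mul] at this
    rw [← hd] at this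
    linarith
  have hcs : (∑ j ∈ S, a v j * x j) ^ 2 ≤ d * ∑ j ∈ S, a v j * x j ^ 2 :=
    Finset.sum_sq_le_sum_mul_sum_of_sq_le_mul S (fun j _ => ha0 v j)
      (fun j _ => mul_nonneg (ha0 v j) (sq_nonneg _)) fun j _ => le_of_eq (by ring)
  -- The complementary weights `1 - a v j` carry mass at least `(|S| - d) * s` of the total `1`.
  have hle : ∑ j ∈ S, a v j * x j ^ 2 ≤ 1 - (S.card - d) * s := by
    have : ∑ j ∈ S, (1 - a v j) * s ≤ ∑ j ∈ S, (1 - a v j) * x j ^ 2 :=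
      Finset.sum_le_sum fun j hj => mul_le_mul_of_nonneg_left (hs j hj) (sub_nonneg.2 (ha v j))
    simp only [sub_mul, one_mul, Finset.sum_sub_distrib, h.norm, ← Finset.sum_mul,
      Finset.sum_const, nsmul_eq_mul] at this
    rw [← hd] at this
    linarith
  calc (q - d) ^ 2 * s ≤ (q - d) ^ 2 * x v ^ 2 :=
        mul_le_mul_of_nonneg_left (hs v hv) (sq_nonneg _)
    _ = (∑ j ∈ S, a v j * x j) ^ 2 := by rw [← heig]; ring
    _ ≤ d * ∑ j ∈ S, a v j * x j ^ 2 := hcs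
    _ ≤ d * (1 - (S.card - d) * s) := mul_le_mul_of_nonneg_left hle hd0

end IsSignlessPerron

/-! ### The potential argument -/

/-- As `(1 - γ)(1 + 2γ) ≥ 1`, the hypothesis gives `(q - d)² ≤ d(2γm + d)`, that is `q² ≤ 2d(q +
γm)`; bound `q²` below by `(q - γm)(q + γm)`. -/
theorem sub_mul_le_two_mul_of_sq_sub_mul_le {m q γ d s : ℝ} (hm : 0 < m) (hq : 0 < q) (hγ : 0 < γ)
    (hγ' : γ ≤ 1 / 2) (hd : 0 ≤ d) (hs : 0 < s) (hms : 1 - γ ≤ m * s)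
    (h : (q - d) ^ 2 * s ≤ d * (1 - (m - d) * s)) : q - γ * m ≤ 2 * d := by
  have hinv : 1 ≤ m * s * (1 + 2 * γ) := by
    have h1 := mul_le_mul_of_nonneg_right hms (by linarith : 0 ≤ 1 + 2 * γ)
    have h2 := mul_nonneg hγ.le (by linarith : 0 ≤ 1 - 2 * γ)
    linarith
  have hsq : (q - d) ^ 2 ≤ d * (2 * γ * m + d) := by
    refine le_of_mul_le_mul_right ?_ hs
    linarith [mul_le_mul_of_nonneg_left hinv hd]
  refine le_of_mul_le_mul_right ?_ (add_pos hq (mul_pos hγ hm))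
  linarith [sq_nonneg (γ * m)]

/-- The potential `q / m + η log m` increases when a vertex with a small entry of the eigenvector is
deleted. -/
theorem add_log_lt_of_le_mul {m P γ ε s q : ℝ} (hγ : 0 < γ) (hε : 0 < ε) (hP : 1 + 2 * ε ≤ P)
    (hP2 : P ≤ 2) (hm : 2 ≤ m) (hmη : 2 < m * (γ * ε)) (hs : 0 ≤ s) (hms : m * s ≤ 1 - γ)
    (h : P * m - 1 - (2 * (P * m) - m) * s ≤ q * (1 - s)) :
    P + γ * ε * Real.log m < q / (m - 1) + γ * ε * Real.log (m - 1) := by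
  have hηpos : 0 < γ * ε := mul_pos hγ hε
  have hm0 : 0 < m := by linarith
  have hm1 : 0 < m - 1 := by linarith
  by_contra! hM
  have hlog : Real.log m - Real.log (m - 1) ≤ 1 / (m - 1) := by
    rw [← Real.log_div hm0.ne' hm1.ne']
    refine (Real.log_le_sub_one_of_pos (div_pos hm0 hm1)).trans (le_of_eq ?_)
    field_simp
    ring
  have hq : q ≤ P * (m - 1) + γ * ε := by
    have h1 : q / (m - 1) ≤ P + γ * ε * (1 / (m - 1)) := by
      linarith [mul_le_mul_of_nonneg_left hlog hηpos.le]
    rw [div_le_iff₀ hm1] at h1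
    refine h1.trans (le_of_eq ?_)
    field_simp
  have hs1 : 0 ≤ 1 - s := by linarith [mul_le_mul_of_nonneg_right hm hs]
  have h2 := h.trans (mul_le_mul_of_nonneg_right hq hs1)
  -- Here `P - 1 ≥ 2ε` and `1 - m * s ≥ γ`. This gain `2γε` beats the logarithm's loss `γε` plus the
  -- error `2s`, which is below `γε`.
  have h3 : (P - 1) * (m * s - 1) ≤ -(2 * (γ * ε)) := by
    have h4 := mul_le_mul_of_nonneg_left hms (by linarith : 0 ≤ P - 1)
    have h5 := mul_le_mul_of_nonneg_left hP hγ.le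
    linarith
  have h6 : 2 * s < γ * ε := by
    refine lt_of_mul_lt_mul_left ?_ hm0.le
    linarith
  linarith [mul_le_mul_of_nonneg_left hP2 hs, mul_nonneg hs hηpos.le]

/-- A graph with large signless Laplacian spectral radius has a large induced subgraph in which
all degrees are large. -/
theorem exists_large_degrees_of_signless {V : Type*} [Fintype V] [Nonempty V] (a : V → V → ℝ)
    (hsymm : ∀ i j, a i j = a j i) (hirr : ∀ i, a i i = 0) (ha0 : ∀ i j, 0 ≤ a i j)
    (ha : ∀ i j, a i j ≤ 1) {ε γ p : ℝ} (hε : 0 < ε) (hγ : 0 < γ) (hγ' : γ ≤ 1 / 2)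
    (hp : 1 + 2 * ε ≤ p) {q₀ : ℝ} {x₀ : V → ℝ} (h₀ : IsSignlessPerron a Finset.univ q₀ x₀)
    (hq₀ : p * Fintype.card V ≤ q₀) :
    ∃ S : Finset V, S.Nonempty ∧
      Real.log (Fintype.card V) ≤ Real.log S.card + 2 / (γ * ε) ∧
      (2 ≤ S.card → 2 / (γ * ε) < S.card →
        ∀ v ∈ S, (p - γ) * S.card ≤ 2 * ∑ j ∈ S, a v j) := by
  classical
  set η := γ * ε with hη
  have hηpos : 0 < η := mul_pos hγ hε
  have hex : ∀ S : Finset V, ∃ (q : ℝ) (x : V → ℝ), S.Nonempty → IsSignlessPerron a S q x := by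
    intro S
    by_cases hS : S.Nonempty
    · obtain ⟨q, x, h1, h2, h3, h4⟩ := exists_signless_eigenvector a hsymm ha0 S hS
      exact ⟨q, x, fun _ => ⟨h1, h2, h3, h4⟩⟩
    · exact ⟨0, 0, fun h => absurd h hS⟩
  choose q x hqx using hex
  -- The logarithm keeps the maximiser large, at a cost of about `η / m` per deletion.
  obtain ⟨S, hSmem, hmax⟩ := (Finset.univ.filter fun S : Finset V => S.Nonempty).exists_max_image
    (fun S => q S / S.card + η * Real.log S.card)
    ⟨Finset.univ, by simp⟩
  have hS : S.Nonempty := (Finset.mem_filter.1 hSmem).2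
  have hP := hqx S hS
  have hmpos : (0 : ℝ) < S.card := by exact_mod_cast hS.card_pos
  have hnpos : (0 : ℝ) < Fintype.card V := by exact_mod_cast Fintype.card_pos
  have hmn : (S.card : ℝ) ≤ Fintype.card V := by exact_mod_cast S.card_le_univ
  have hlogmn := Real.log_le_log hmpos hmn
  have hq₀' : q₀ ≤ q Finset.univ := by
    have := (hqx Finset.univ Finset.univ_nonempty).bound x₀
    rwa [h₀.form_eq, h₀.norm, mul_one] at this
  have huniv : p + η * Real.log (Fintype.card V) ≤ q S / S.card + η * Real.log S.card := by
    have h1 := hmax Finset.univ (by simp)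
    rw [Finset.card_univ] at h1
    have h2 : p ≤ q Finset.univ / Fintype.card V := by
      rw [le_div_iff₀ hnpos]
      exact hq₀.trans hq₀'
    linarith
  set P := q S / S.card with hPdef
  have hqP : q S = P * S.card := by rw [hPdef]; field_simp
  have hP2 : P ≤ 2 := by
    rw [hPdef, div_le_iff₀ hmpos]
    exact hP.le_two_mul_card ha
  clear_value P
  have hpP : p ≤ P := by nlinarith
  refine ⟨S, hS, ?_, fun hm2 hmη v hv => ?_⟩
  · have : Real.log (Fintype.card V) - Real.log S.card ≤ 2 / η := by
      rw [le_div_iff₀ hηpos]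
      nlinarith
    linarith
  obtain ⟨u, hu, humin⟩ := S.exists_min_image (x S) hS
  set s := x S u ^ 2 with hs
  have hs0 : 0 ≤ s := sq_nonneg _
  have hsmin : ∀ i ∈ S, s ≤ x S i ^ 2 := fun i hi =>
    pow_le_pow_left₀ (hP.nonneg u hu) (humin i hi) 2
  have hms : S.card * s ≤ 1 := by
    rw [← hP.norm, ← nsmul_eq_mul]
    exact Finset.card_nsmul_le_sum _ _ _ hsmin
  have hmη' : 2 < S.card * η := by rwa [div_lt_iff₀ hηpos] at hmη
  have hbig : 1 - γ < S.card * s := by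
    by_contra! hsmall
    have hcard : ((S.erase u).card : ℝ) = S.card - 1 := by
      rw [Finset.card_erase_of_mem hu, Nat.cast_pred hS.card_pos]
    have hm2' : (2 : ℝ) ≤ S.card := by exact_mod_cast hm2
    have hne : (S.erase u).Nonempty := by
      rw [← Finset.card_pos, Finset.card_erase_of_mem hu]
      omega
    have hB := hP.erase_bound ha hsymm hirr hu humin (hqx _ hne)
    have hM := hmax (S.erase u) (by simp [hne])
    rw [hcard] at hM
    rw [hqP] at hB
    exact hM.not_gt (add_log_lt_of_le_mul hγ hε (hp.trans hpP) hP2 hm2' hmη' hs0 hsmall hB)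
  clear_value s
  have hspos : 0 < s := by
    by_contra! h
    nlinarith
  have hD := hP.sq_sub_degree_mul_le ha0 ha hsmin hv
  set d := ∑ j ∈ S, a v j with hd
  have hd0 : 0 ≤ d := Finset.sum_nonneg fun j _ => ha0 v j
  have hqpos : 0 < q S := by
    rw [hqP]
    exact mul_pos (by linarith) hmpos
  have h7 := sub_mul_le_two_mul_of_sq_sub_mul_le hmpos hqpos hγ hγ' hd0 hspos hbig.le hD
  nlinarith [mul_le_mul_of_nonneg_right hpP hmpos.le]

/-! ### Combining the two halves -/

/-- Evaluate the quadratic bound at an eigenvector for the spectral radius; this one inequality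
suffices to transfer the lower bound. -/
theorem SimpleGraph.exists_isSignlessPerron_univ {V : Type*} [Fintype V] [DecidableEq V]
    [Nonempty V] (G : SimpleGraph V) [DecidableRel G.Adj] :
    ∃ (q : ℝ) (x : V → ℝ),
      IsSignlessPerron (fun i j => if G.Adj i j then (1 : ℝ) else 0) Finset.univ q x ∧
      G.signlessSpectralRadius ≤ q := by
  obtain ⟨q, x, h1, h2, h3, h4⟩ := exists_signless_eigenvector
    (fun i j => if G.Adj i j then (1 : ℝ) else 0) (fun i j => by simp only [G.adj_comm])
    (fun i j => by split_ifs <;> norm_num) Finset.univ Finset.univ_nonempty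
  refine ⟨q, x, ⟨h1, h2, h3, h4⟩, ?_⟩
  obtain ⟨v, hv, hv0⟩ := G.isGreatest_signlessSpectralRadius.1.exists_hasEigenvector
  rw [Module.End.mem_eigenspace_iff, Matrix.toLin'_apply] at hv
  have hvpos : 0 < ∑ i, v i ^ 2 := by
    obtain ⟨i, hi⟩ := Function.ne_iff.1 hv0
    exact Finset.sum_pos' (fun _ _ => sq_nonneg _) ⟨i, Finset.mem_univ i, by
      have : v i ≠ 0 := hi
      positivity⟩
  refine le_of_mul_le_mul_right ((le_of_eq ?_).trans (h4 v)) hvpos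
  rw [Finset.mul_sum]
  refine Finset.sum_congr rfl fun i _ => ?_
  have hi := congrFun hv i
  rw [SimpleGraph.signlessLapMatrix, Matrix.add_mulVec, Pi.add_apply,
    SimpleGraph.degMatrix_mulVec_apply, SimpleGraph.adjMatrix_mulVec_apply, Pi.smul_apply,
    smul_eq_mul] at hi
  have : ∑ j, (if G.Adj i j then (1 : ℝ) else 0) * (v i + v j) =
      G.degree i * v i + ∑ j ∈ G.neighborFinset i, v j := by
    simp only [ite_mul, one_mul, zero_mul]
    rw [← Finset.sum_filter, ← SimpleGraph.neighborFinset_eq_filter, Finset.sum_add_distrib,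
      Finset.sum_const, nsmul_eq_mul, SimpleGraph.card_neighborFinset_eq_degree]
  rw [this, hi]
  ring

theorem theorem2p4 (k : ℕ) (hk : 2 ≤ k) (ε : ℝ) (hε : 0 < ε) :
    ∃ c : ℝ, 0 < c ∧ ∃ n₀ : ℕ,
      ∀ (V : Type*) [Fintype V] [DecidableEq V] (G : SimpleGraph V) [DecidableRel G.Adj] (n : ℕ),
        Fintype.card V = n → n₀ ≤ n →
        (1 - 1 / (k : ℝ) + ε) * (2 * (n : ℝ)) ≤ G.signlessSpectralRadius →
        ∃ t : ℕ, c * Real.log n ≤ t ∧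
          (SimpleGraph.completeEquipartiteGraph (k + 1) t).IsContained G := by
  have hk2 : (2 : ℝ) ≤ k := by exact_mod_cast hk
  have hk0 : (0 : ℝ) < k := by linarith
  -- The degree slack is `kε - kγ/2`, at least `kε/2` because `γ ≤ ε`.
  obtain ⟨c, hc, N, hN⟩ :=
    SimpleGraph.exists_hasBlowup_of_le_card_neighbors k (k * ε / 2) (by positivity)
  set γ := min ε (1 / 2) with hγdef
  have hγ : 0 < γ := lt_min hε (by norm_num)
  set C := 2 / (γ * ε) with hC
  have hCpos : 0 < C := by positivity
  set M := max N (max 2 (⌊C⌋₊ + 1)) with hM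
  have hMpos : (0 : ℝ) < M := by
    exact_mod_cast lt_of_lt_of_le two_pos ((le_max_left _ _).trans (le_max_right _ _))
  -- The first threshold gives `|S| ≥ M`. The second lets half of `c log n` absorb the loss `c * C`
  -- and the rounding by `1`.
  obtain ⟨n₀, hn₀⟩ := Filter.eventually_atTop.1
    ((Real.tendsto_log_atTop.comp tendsto_natCast_atTop_atTop).eventually_ge_atTop
      (max (Real.log M + C) (2 * C + 2 / c)))
  refine ⟨c / 2, by positivity, max n₀ 1, fun V _ _ G _ n hVn hn hq => ?_⟩
  have hlogn := hn₀ n ((le_max_left _ _).trans hn)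
  rw [Function.comp_apply, max_le_iff] at hlogn
  have hn1 : 0 < n := (le_max_right _ _).trans hn
  have : Nonempty V := Fintype.card_pos_iff.1 (hVn ▸ hn1)
  obtain ⟨q, x, hqx, hGq⟩ := G.exists_isSignlessPerron_univ
  have hkinv : 1 / (k : ℝ) ≤ 1 / 2 := one_div_le_one_div_of_le two_pos hk2
  obtain ⟨S, hS, hSlog, hdeg⟩ := exists_large_degrees_of_signless
    (fun i j => if G.Adj i j then (1 : ℝ) else 0) (fun i j => by simp only [G.adj_comm])
    (fun i => by simp) (fun i j => by split_ifs <;> norm_num)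
    (fun i j => by split_ifs <;> norm_num) hε hγ (min_le_right _ _)
    -- `p ≥ 1 + 2ε` is where `k ≥ 2` enters.
    (p := 2 * (1 - 1 / (k : ℝ) + ε)) (by linarith) hqx (by
      rw [hVn]
      linarith)
  rw [hVn] at hSlog
  have hSpos : (0 : ℝ) < S.card := by exact_mod_cast hS.card_pos
  have hMS : M ≤ S.card := by
    have : Real.log M ≤ Real.log S.card := by linarith [hlogn.1]
    exact_mod_cast (Real.log_le_log_iff hMpos hSpos).1 this
  have hSC : C < S.card := by
    refine (Nat.lt_floor_add_one C).trans_le ?_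
    exact_mod_cast ((le_max_right _ _).trans (le_max_right _ _)).trans hMS
  have hdeg' := hdeg (((le_max_left _ _).trans (le_max_right _ _)).trans hMS) hSC
  have hlogS : 0 ≤ Real.log S.card := Real.log_natCast_nonneg _
  refine ⟨⌊c * Real.log S.card⌋₊, ?_, SimpleGraph.HasBlowup.isContained
    (hN V G S ((le_max_left _ _).trans hMS) (fun v hv => ?_) _ (Nat.floor_le (by positivity)))⟩
  · have h1 := Nat.lt_floor_add_one (c * Real.log S.card)
    have h2 := mul_le_mul_of_nonneg_left hSlog hc.le
    have h3 := mul_le_mul_of_nonneg_left hlogn.2 hc.le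
    have h4 : c * (2 * C + 2 / c) = 2 * (c * C) + 2 := by field_simp
    rw [h4] at h3
    linarith
  · have h1 := hdeg' v hv
    rw [← Finset.sum_filter, Finset.sum_const, nsmul_eq_mul, mul_one] at h1
    have h2 := mul_le_mul_of_nonneg_left h1 hk0.le
    have h3 := mul_le_mul_of_nonneg_left (min_le_left ε (1 / 2)) (mul_nonneg hk0.le hSpos.le)
    rw [← hγdef] at h3
    have h4 : (k : ℝ) * ((2 * (1 - 1 / (k : ℝ) + ε) - γ) * S.card) =
        2 * ((k - 1 + k * ε) * S.card) - k * S.card * γ := by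
      field_simp
    rw [h4] at h2
    linarith
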